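/- **Theorem 6.1.** Let $m<0$, $\beta<0$ and $\alpha\in\mathbb R$, and consider the self-similar profile equation $$(u^{m-1}u')'+\beta\chi u'+\alpha u=0,\qquad {}'=\frac{d}{d\chi},\quad u>0,$$ written with $v=u^{m-1}u'$ as the extended autonomous system $$\chi'=1,\qquad u'=u^{1-m}v,\qquad v'=-\beta\chi u^{1-m}v-\alpha u .\tag{1}$$ The directional embedding $\chi=\chi$, $u=1/s$, $v=x/s$ and the change of time $dt/d\tau=s^{1-m}$ (where $t$ is the time of (1)) transform (1) into the desingularized system $$\dot\chi=s^{1-m},\qquad \dot s=-sx,\qquad \dot x=-x^2-\beta\chi x-\alpha s^{1-m},\tag{2}$$ considered on $\{s\ge 0\}$. For $\chi_0>0$ let $M_{\ge\chi_0}=\{(\chi,0,-\beta\chi) : \chi\ge\chi_0\}$, a normally attracting branch of equilibria of (2). Its stable manifold is the set of all points of $\{s\ge0\}$ whose forward orbit under (2) exists for all $\tau\ge 0$ and whose distance to $M_{\ge\chi_0}$ tends to $0$ as $\tau\to\infty$. Let $\chi_0>0$, $u_0>0$, $v_0\in\mathbb R$ be such that the image $(\chi_0,1/u_0,v_0/u_0)$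 of $(\chi_0,u_0,v_0)$ under the directional embedding lies on the stable manifold of $M_{\ge\chi_0}$. Then the (forward) maximal solution $(\chi,u(\chi),v(\chi))$ of (1) with $u>0$ starting at $(\chi_0,u_0,v_0)$ is a blow-up solution: its maximal interval of existence is $[\chi_0,\chi_{\max})$ with $\chi_0<\chi_{\max}<\infty$, $u(\chi)\to+\infty$ and $v(\chi)\to+\infty$ as $\chi\to\chi_{\max}-0$, and there are constants $c_u,c_v>0$ such that $$u(\chi)\sim c_u(\chi_{\max}-\chi)^{-1/(1-m)},\qquad v(\chi)\sim c_v(\chi_{\max}-\chi)^{-1/(1-m)}\qquad\text{as }\chi\to\chi_{\max}-0,$$ where $f\sim g$ means $f/g\to1$. -/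

import Mathlib

open Set Filter Topology

noncomputable section

/-- The vector field of the first-order extended autonomous system of the self-similar profile
equation `(u^(m-1) u')' + β χ u' + α u = 0`, where `v = u^(m-1) u'` and points are `(χ, u, v)`:
`χ' = 1`, `u' = u^(1-m) v`, `v' = -β χ u^(1-m) v - α u`. It is used on the phase space `u > 0`. -/
def profileField (m α β : ℝ) (p : ℝ × ℝ × ℝ) : ℝ × ℝ × ℝ :=
  (1,
   p.2.1 ^ (1 - m) * p.2.2,
   -β * p.1 * p.2.1 ^ (1 - m) * p.2.2 - α * p.2.1)

/-- The directional embedding of type `(0,1,1)` on `u > 0`: `(χ, u, v) ↦ (χ, s, x)` with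
`u = 1 / s` and `v = x / s`. -/
def directionalEmbedding (p : ℝ × ℝ × ℝ) : ℝ × ℝ × ℝ :=
  (p.1, 1 / p.2.1, p.2.2 / p.2.1)

/-- The desingularized vector field in the coordinates `(χ, s, x)`, obtained from `profileField`
by the directional embedding and the change of time `dt/dτ = s^(1-m)`. -/
def desingField (m α β : ℝ) (p : ℝ × ℝ × ℝ) : ℝ × ℝ × ℝ :=
  (p.2.1 ^ (1 - m),
   -p.2.1 * p.2.2,
   -p.2.2 ^ 2 - β * p.1 * p.2.2 - α * p.2.1 ^ (1 - m))

/-- The closed half-space `s ≥ 0`: the image `s > 0` of the embedding together with the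
horizon `s = 0`. -/
def desingDomain : Set (ℝ × ℝ × ℝ) := {p | 0 ≤ p.2.1}

/-- The branch `{(χ, 0, -β χ) | χ ≥ χ₀}` of equilibria on the horizon. -/
def equilibriumBranch (β χ₀ : ℝ) : Set (ℝ × ℝ × ℝ) :=
  {p | χ₀ ≤ p.1 ∧ p.2.1 = 0 ∧ p.2.2 = -β * p.1}

/-- The stable manifold of a set `M` for the vector field `g` on the phase space `D`: all points
whose forward orbit exists in `D` for all times `τ ≥ 0` and converges to `M`. -/
def stableManifold (g : ℝ × ℝ × ℝ → ℝ × ℝ × ℝ) (D M : Set (ℝ × ℝ × ℝ)) : Set (ℝ × ℝ × ℝ) :=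
  {p | ∃ γ : ℝ → ℝ × ℝ × ℝ,
    γ 0 = p ∧ IsIntegralCurveOn γ (fun _ => g) (Ici 0) ∧ (∀ τ, 0 ≤ τ → γ τ ∈ D) ∧
      Tendsto (fun τ => Metric.infDist (γ τ) M) atTop (𝓝 0)}

/-- The half-open interval `[χ₀, T)`, where `T` may be `+∞`. -/
def forwardInterval (χ₀ : ℝ) (T : EReal) : Set ℝ := {χ | χ₀ ≤ χ ∧ (χ : EReal) < T}

/-- `χ ↦ (χ, u χ, v χ)` is a solution of the extended profile system on the nondegenerate interval
`[χ₀, T)` that stays in the phase space `u > 0` and starts at `(χ₀, u₀, v₀)`. Since `χ' = 1`, the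
independent variable may be taken to be `χ` itself. -/
structure IsProfileSolution (m α β χ₀ u₀ v₀ : ℝ) (T : EReal) (u v : ℝ → ℝ) : Prop where
  lt : (χ₀ : EReal) < T
  init_u : u χ₀ = u₀
  init_v : v χ₀ = v₀
  pos : ∀ χ ∈ forwardInterval χ₀ T, 0 < u χ
  ode : IsIntegralCurveOn (fun χ => (χ, u χ, v χ)) (fun _ => profileField m α β)
    (forwardInterval χ₀ T)

/-- A solution on `[χ₀, T)` that cannot be continued (forward) to a longer interval. -/
structure IsMaximalProfileSolution (m α β χ₀ u₀ v₀ : ℝ) (T : EReal) (u v : ℝ → ℝ) : Prop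
    extends IsProfileSolution m α β χ₀ u₀ v₀ T u v where
  maximal : ∀ (T' : EReal) (u' v' : ℝ → ℝ), IsProfileSolution m α β χ₀ u₀ v₀ T' u' v' →
    T ≤ T' → EqOn u' u (forwardInterval χ₀ T) → EqOn v' v (forwardInterval χ₀ T) → T' = T

end

/-!
The orbit `(X, S, Y)` of the desingularized system through the given point converges to the branch
`{(χ, 0, -β χ) | χ ≥ χ₀}`, so `S → 0` and `Y + β X → 0`; since `X` is eventually close to `[χ₀, ∞)`,
`Y` is eventually bounded below by a constant `c > 0`. Along the orbit `S' = -S Y`, hence `S`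
stays positive (`pos_of_hasDerivWithinAt_neg_mul`), and `X' = S ^ (1 - m)`, so
`X + S ^ (1 - m) / ((1 - m) c)` is eventually nonincreasing. This bounds `X`
(`le_add_rpow_div_of_rate`); being strictly increasing, `X` converges to a finite limit `χmax`
without reaching it, and `Y → -β χmax > 0`.

Inverting `χ = X τ` (`exists_inverse_of_strictMonoOn`) and setting `u = 1 / S`, `v = Y / S` as
functions of `χ` gives a solution of the profile system on `[χ₀, χmax)` with `u → ∞` and
`v / u → -β χmax` (`exists_blowup_solution`). The profile field is smooth on `u > 0`, so solutions
are unique. As `u` blows up at `χmax`, this solution is maximal and every maximal solution agrees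
with it.

For the rate, `(u ^ (m - 1))' = -(1 - m) v / u → (1 - m) β χmax` while `u ^ (m - 1) → 0`. By
l'Hôpital's rule `u ^ (m - 1) / (χmax - χ)` converges to a positive limit, and raising this to the
power `-1 / (1 - m)` gives the asymptotics of `u` (`IsProfileSolution.tendsto_div_rpow`). That of
`v = (v / u) u` follows.
-/

/-! ### Uniqueness and maximality of profile solutions -/

/-- Forward uniqueness for a `C¹` autonomous field: both curves run in a compact subset of `U`, on
which the field is Lipschitz. -/
theorem IsIntegralCurveOn.eqOn_Icc_of_contDiffAt {E : Type*} [NormedAddCommGroup E]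
    [NormedSpace ℝ E] {g : E → E} {U : Set E} (hg : ∀ p ∈ U, ContDiffAt ℝ 1 g p)
    {γ₁ γ₂ : ℝ → E} {a b : ℝ} (h₁ : IsIntegralCurveOn γ₁ (fun _ => g) (Icc a b))
    (h₂ : IsIntegralCurveOn γ₂ (fun _ => g) (Icc a b)) (hU₁ : MapsTo γ₁ (Icc a b) U)
    (hU₂ : MapsTo γ₂ (Icc a b) U) (ha : γ₁ a = γ₂ a) : EqOn γ₁ γ₂ (Icc a b) := by
  have hc₁ : ContinuousOn γ₁ (Icc a b) := fun t ht => (h₁ t ht).continuousWithinAt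
  have hc₂ : ContinuousOn γ₂ (Icc a b) := fun t ht => (h₂ t ht).continuousWithinAt
  have hlip : LocallyLipschitzOn (γ₁ '' Icc a b ∪ γ₂ '' Icc a b) g := by
    intro p hp
    have hpU : p ∈ U := by
      rcases hp with ⟨t, ht, rfl⟩ | ⟨t, ht, rfl⟩
      exacts [hU₁ ht, hU₂ ht]
    obtain ⟨K, t, ht, hK⟩ := (hg p hpU).exists_lipschitzOnWith
    exact ⟨K, t, mem_nhdsWithin_of_mem_nhds ht, hK⟩
  obtain ⟨K, hK⟩ := hlip.exists_lipschitzOnWith_of_compact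
    ((isCompact_Icc.image_of_continuousOn hc₁).union (isCompact_Icc.image_of_continuousOn hc₂))
  refine ODE_solution_unique_of_mem_Icc_right (v := fun _ => g) (fun _ _ => hK) hc₁ ?_
    (fun t ht => Or.inl (mem_image_of_mem _ (Ico_subset_Icc_self ht))) hc₂ ?_
    (fun t ht => Or.inr (mem_image_of_mem _ (Ico_subset_Icc_self ht))) ha
  · exact fun t ht => ((h₁ t (Ico_subset_Icc_self ht)).mono_of_mem_nhdsWithin
      (Icc_mem_nhdsGE_of_mem ht))
  · exact fun t ht => ((h₂ t (Ico_subset_Icc_self ht)).mono_of_mem_nhdsWithin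
      (Icc_mem_nhdsGE_of_mem ht))

theorem contDiffAt_profileField (m α β : ℝ) {p : ℝ × ℝ × ℝ} (hp : 0 < p.2.1) :
    ContDiffAt ℝ 1 (profileField m α β) p := by
  have hu : ContDiffAt ℝ 1 (fun q : ℝ × ℝ × ℝ => q.2.1 ^ (1 - m)) p :=
    ContDiffAt.rpow_const_of_ne (by fun_prop) hp.ne'
  unfold profileField
  fun_prop

theorem forwardInterval_coe (a b : ℝ) : forwardInterval a (b : EReal) = Ico a b := by
  ext x
  simp [forwardInterval]

theorem Icc_subset_forwardInterval {a b : ℝ} {T : EReal} (hb : (b : EReal) < T) :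
    Icc a b ⊆ forwardInterval a T := fun _ hx =>
  ⟨hx.1, (EReal.coe_le_coe_iff.2 hx.2).trans_lt hb⟩

theorem IsProfileSolution.eq_of_lt {m α β χ₀ u₀ v₀ : ℝ} {T₁ T₂ : EReal} {u₁ v₁ u₂ v₂ : ℝ → ℝ}
    (h₁ : IsProfileSolution m α β χ₀ u₀ v₀ T₁ u₁ v₁)
    (h₂ : IsProfileSolution m α β χ₀ u₀ v₀ T₂ u₂ v₂) {χ : ℝ} (hχ : χ₀ ≤ χ)
    (hχ₁ : (χ : EReal) < T₁) (hχ₂ : (χ : EReal) < T₂) : u₁ χ = u₂ χ ∧ v₁ χ = v₂ χ := by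
  have s₁ := Icc_subset_forwardInterval (a := χ₀) hχ₁
  have s₂ := Icc_subset_forwardInterval (a := χ₀) hχ₂
  have key := IsIntegralCurveOn.eqOn_Icc_of_contDiffAt (U := {p : ℝ × ℝ × ℝ | 0 < p.2.1})
    (fun p hp => contDiffAt_profileField m α β hp)
    (fun t ht => (h₁.ode t (s₁ ht)).mono s₁) (fun t ht => (h₂.ode t (s₂ ht)).mono s₂)
    (fun t ht => h₁.pos t (s₁ ht)) (fun t ht => h₂.pos t (s₂ ht))
    (by simp [h₁.init_u, h₁.init_v, h₂.init_u, h₂.init_v]) (right_mem_Icc.2 hχ)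
  simpa using key

/-- A solution whose first component blows up at `b` bounds the interval of existence of every
solution with the same initial data: one defined at `b` would be continuous there. -/
theorem IsProfileSolution.le_of_tendsto_atTop {m α β χ₀ u₀ v₀ b : ℝ} {T : EReal}
    {u v u' v' : ℝ → ℝ} (h : IsProfileSolution m α β χ₀ u₀ v₀ (b : EReal) u v)
    (hu : Tendsto u (𝓝[<] b) atTop) (h' : IsProfileSolution m α β χ₀ u₀ v₀ T u' v') :
    T ≤ (b : EReal) := by
  by_contra! hT
  have hb : χ₀ < b := EReal.coe_lt_coe_iff.1 h.lt
  have hmem : b ∈ forwardInterval χ₀ T := ⟨hb.le, hT⟩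
  have hcont : ContinuousWithinAt u' (Ico χ₀ b) b :=
    ((h'.ode b hmem).continuousWithinAt.snd.fst).mono
      (Ico_subset_Icc_self.trans (Icc_subset_forwardInterval hT))
  have hlim : Tendsto u' (𝓝[<] b) (𝓝 (u' b)) := by
    rw [← nhdsWithin_Ico_eq_nhdsLT hb]
    exact hcont
  refine not_tendsto_nhds_of_tendsto_atTop (hu.congr' ?_) _ hlim
  filter_upwards [Ico_mem_nhdsLT hb] with χ hχ
  have hχb : (χ : EReal) < b := EReal.coe_lt_coe_iff.2 hχ.2
  exact (h.eq_of_lt h' hχ.1 hχb (hχb.trans hT)).1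

theorem IsProfileSolution.isMaximal_of_tendsto_atTop {m α β χ₀ u₀ v₀ b : ℝ} {u v : ℝ → ℝ}
    (h : IsProfileSolution m α β χ₀ u₀ v₀ (b : EReal) u v) (hu : Tendsto u (𝓝[<] b) atTop) :
    IsMaximalProfileSolution m α β χ₀ u₀ v₀ (b : EReal) u v :=
  ⟨h, fun _ _ _ h' hle _ _ => (h.le_of_tendsto_atTop hu h').antisymm hle⟩

theorem IsMaximalProfileSolution.eq_of_tendsto_atTop {m α β χ₀ u₀ v₀ b : ℝ} {T : EReal}
    {u v u' v' : ℝ → ℝ} (h : IsProfileSolution m α β χ₀ u₀ v₀ (b : EReal) u v)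
    (hu : Tendsto u (𝓝[<] b) atTop) (h' : IsMaximalProfileSolution m α β χ₀ u₀ v₀ T u' v') :
    T = (b : EReal) := by
  have hle := h.le_of_tendsto_atTop hu h'.toIsProfileSolution
  have heq : ∀ χ ∈ forwardInterval χ₀ T, u χ = u' χ ∧ v χ = v' χ := fun χ hχ =>
    h.eq_of_lt h'.toIsProfileSolution hχ.1 (hχ.2.trans_le hle) hχ.2
  exact (h'.maximal b u v h hle (fun χ hχ => (heq χ hχ).1) (fun χ hχ => (heq χ hχ).2)).symm

/-! ### The blow-up rate -/

theorem isEquivalent_const_mul_of_tendsto_div {l : Filter ℝ} {f g : ℝ → ℝ} {c : ℝ} (hc : c ≠ 0)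
    (h : Tendsto (fun x => f x / g x) l (𝓝 c)) (hg : ∀ᶠ x in l, g x ≠ 0) :
    Asymptotics.IsEquivalent l f (fun x => c * g x) := by
  have hcg : ∀ᶠ x in l, c * g x ≠ 0 := hg.mono fun x hx => mul_ne_zero hc hx
  rw [Asymptotics.isEquivalent_iff_tendsto_one hcg]
  have := h.div_const c
  rw [div_self hc] at this
  refine this.congr fun x => ?_
  simp only [Pi.div_apply]
  rw [div_div, mul_comm]

/-- The blow-up rate: `u ^ (m - 1)` vanishes at `b` with slope `-(1 - m) ℓ`, where `ℓ` is the limit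
of `v / u`. -/
theorem IsProfileSolution.tendsto_div_rpow {m α β χ₀ u₀ v₀ b ℓ : ℝ} {u v : ℝ → ℝ} (hm : m < 0)
    (h : IsProfileSolution m α β χ₀ u₀ v₀ (b : EReal) u v) (hu : Tendsto u (𝓝[<] b) atTop)
    (hℓ : 0 < ℓ) (hvu : Tendsto (fun χ => v χ / u χ) (𝓝[<] b) (𝓝 ℓ)) :
    Tendsto (fun χ => u χ / (b - χ) ^ (-(1 / (1 - m)))) (𝓝[<] b)
      (𝓝 (((1 - m) * ℓ) ^ (-(1 / (1 - m))))) := by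
  have hb : χ₀ < b := EReal.coe_lt_coe_iff.1 h.lt
  have hm1 : 0 < 1 - m := by linarith
  have hpos : ∀ χ ∈ Ioo χ₀ b, 0 < u χ := fun χ hχ =>
    h.pos χ (by rw [forwardInterval_coe]; exact Ioo_subset_Ico_self hχ)
  have hderiv : ∀ χ ∈ Ioo χ₀ b, HasDerivAt (fun y => u y ^ (m - 1)) (-((1 - m) * (v χ / u χ))) χ := by
    intro χ hχ
    have h1 := h.ode χ (by rw [forwardInterval_coe]; exact Ioo_subset_Ico_self hχ)
    rw [forwardInterval_coe] at h1
    have h2 : HasDerivAt u (u χ ^ (1 - m) * v χ) χ :=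
      (h1.hasDerivAt (Ico_mem_nhds hχ.1 hχ.2)).snd.fst
    convert h2.rpow_const (p := m - 1) (Or.inl (hpos χ hχ).ne') using 1
    have h3 : u χ ^ (1 - m) * u χ ^ (m - 1 - 1) = (u χ)⁻¹ := by
      rw [← Real.rpow_add (hpos χ hχ), ← Real.rpow_neg_one]
      ring_nf
    rw [div_eq_mul_inv, ← h3]
    ring
  have hw0 : Tendsto (fun y => u y ^ (m - 1)) (𝓝[<] b) (𝓝 0) := by
    have := (tendsto_rpow_neg_atTop hm1).comp hu
    simpa [Function.comp_def] using this
  have hlin0 : Tendsto (fun y => b - y) (𝓝[<] b) (𝓝 0) := by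
    have : ContinuousAt (fun y : ℝ => b - y) b := by fun_prop
    simpa [ContinuousAt] using this.mono_left (nhdsWithin_le_nhds (s := Iio b))
  have hlim : Tendsto (fun y => u y ^ (m - 1) / (b - y)) (𝓝[<] b) (𝓝 ((1 - m) * ℓ)) := by
    refine HasDerivAt.lhopital_zero_left_on_Ioo (g' := fun _ => -1) hb hderiv
      (fun y _ => by simpa using (hasDerivAt_id y).const_sub b) (by simp) hw0 hlin0 ?_
    simpa [neg_mul, neg_div_neg_eq] using hvu.const_mul (1 - m)
  have hpow := hlim.rpow_const (p := -(1 / (1 - m))) (Or.inl (by positivity))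
  refine hpow.congr' ?_
  filter_upwards [Ioo_mem_nhdsLT hb] with χ hχ
  have hu0 := hpos χ hχ
  rw [Real.div_rpow (by positivity) (by linarith [hχ.2]), ← Real.rpow_mul hu0.le]
  have : (m - 1) * -(1 / (1 - m)) = 1 := by field_simp; ring
  rw [this, Real.rpow_one]

/-! ### Orbits on the stable manifold -/

/-- An orbit off the horizon `s = 0` never reaches it: `S exp (∫ Y)` is conserved. -/
theorem pos_of_hasDerivWithinAt_neg_mul {S Y : ℝ → ℝ}
    (hS : ∀ τ, 0 ≤ τ → HasDerivWithinAt S (-S τ * Y τ) (Ici 0) τ)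
    (hY : ContinuousOn Y (Ici 0)) (h0 : 0 < S 0) {τ : ℝ} (hτ : 0 ≤ τ) : 0 < S τ := by
  -- `Y` is controlled only on `[0, ∞)`; this extension of it is continuous on the whole line.
  set y : ℝ → ℝ := fun t => Y (max t 0) with hy
  have hyc : Continuous y :=
    hY.comp_continuous (by fun_prop) fun t => le_max_right t 0
  set I : ℝ → ℝ := fun t => ∫ r in (0 : ℝ)..t, y r with hI
  have hId : ∀ t, HasDerivAt I (y t) t := fun t => hyc.integral_hasStrictDerivAt 0 t |>.hasDerivAt
  have hd : ∀ t, 0 ≤ t → HasDerivWithinAt (fun r => S r * Real.exp (I r)) 0 (Ici 0) t := by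
    intro t ht
    refine ((hS t ht).mul (hId t).exp.hasDerivWithinAt).congr_deriv ?_
    simp only [hy, max_eq_left ht]
    ring
  have hconst := constant_of_has_deriv_right_zero (a := 0) (b := τ)
    (f := fun r => S r * Real.exp (I r))
    (fun t ht => (hd t ht.1).continuousWithinAt.mono Icc_subset_Ici_self)
    (fun t ht => (hd t ht.1).mono (Ici_subset_Ici.2 ht.1)) τ (right_mem_Icc.2 hτ)
  have : I 0 = 0 := by simp [hI]
  simp only [this, Real.exp_zero, mul_one] at hconst
  exact pos_of_mul_pos_left (hconst ▸ h0) (Real.exp_pos _).le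

/-- Convergence to the branch in distance controls `s`, the defect `x + β χ` and, from below, `χ`;
no convergence of `χ` itself is presupposed. -/
theorem abs_le_infDist_equilibriumBranch (β χ₀ : ℝ) (p : ℝ × ℝ × ℝ) :
    |p.2.1| ≤ Metric.infDist p (equilibriumBranch β χ₀) ∧
      |p.2.2 + β * p.1| ≤ (1 + |β|) * Metric.infDist p (equilibriumBranch β χ₀) ∧
      χ₀ - p.1 ≤ Metric.infDist p (equilibriumBranch β χ₀) := by
  have hne : (equilibriumBranch β χ₀).Nonempty := ⟨(χ₀, 0, -β * χ₀), le_rfl, rfl, rfl⟩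
  have key : ∀ q ∈ equilibriumBranch β χ₀, |p.1 - q.1| ≤ dist p q ∧ |p.2.1| ≤ dist p q ∧
      |p.2.2 + β * q.1| ≤ dist p q := by
    rintro ⟨q1, q2, q3⟩ ⟨-, h2, h3⟩
    simp only at h2 h3
    subst h2 h3
    simp [Prod.dist_eq, Real.dist_eq]
  refine ⟨(Metric.le_infDist hne).2 fun {q} hq => (key q hq).2.1, ?_,
    (Metric.le_infDist hne).2 fun {q} hq => ?_⟩
  · rw [← div_le_iff₀' (by positivity)]
    refine (Metric.le_infDist hne).2 fun {q} hq => ?_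
    obtain ⟨h1, -, h3⟩ := key _ hq
    rw [div_le_iff₀' (by positivity)]
    calc |p.2.2 + β * p.1| = |(p.2.2 + β * q.1) + β * (p.1 - q.1)| := by ring_nf
      _ ≤ |p.2.2 + β * q.1| + |β| * |p.1 - q.1| := by
        rw [← abs_mul]; exact abs_add_le _ _
      _ ≤ dist p q + |β| * dist p q := by gcongr
      _ = (1 + |β|) * dist p q := by ring
  · linarith [(key _ hq).1, neg_le_abs (p.1 - q.1), hq.1]

/-- If `Y ≥ c > 0` from time `τ₀` on, then `X` stays bounded, because `X + S ^ k / (k c)` is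
nonincreasing from then on. -/
theorem le_add_rpow_div_of_rate {k c τ₀ : ℝ} {X S Y : ℝ → ℝ} (hk : 0 < k) (hc : 0 < c) (hτ₀ : 0 ≤ τ₀)
    (hX : ∀ τ, 0 ≤ τ → HasDerivWithinAt X (S τ ^ k) (Ici 0) τ)
    (hS : ∀ τ, 0 ≤ τ → HasDerivWithinAt S (-S τ * Y τ) (Ici 0) τ)
    (hpos : ∀ τ, 0 ≤ τ → 0 < S τ) (hY : ∀ τ, τ₀ ≤ τ → c ≤ Y τ) {τ : ℝ} (hτ : τ₀ ≤ τ) :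
    X τ ≤ X τ₀ + S τ₀ ^ k / (k * c) := by
  have hd : ∀ t, 0 ≤ t → HasDerivWithinAt (fun r => X r + S r ^ k / (k * c))
      (S t ^ k * (1 - Y t / c)) (Ici 0) t := by
    intro t ht
    refine ((hX t ht).add (((hS t ht).rpow_const (p := k)
      (Or.inl (hpos t ht).ne')).div_const (k * c))).congr_deriv ?_
    rw [Real.rpow_sub_one (hpos t ht).ne']
    have := (hpos t ht).ne'
    field_simp
    ring
  have hanti : AntitoneOn (fun r => X r + S r ^ k / (k * c)) (Ici τ₀) := by
    refine antitoneOn_of_hasDerivWithinAt_nonpos (convex_Ici τ₀)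
      (f' := fun t => S t ^ k * (1 - Y t / c))
      (fun t ht => (hd t (hτ₀.trans ht)).continuousWithinAt.mono (Ici_subset_Ici.2 hτ₀)) ?_ ?_
    · rw [interior_Ici]
      exact fun t ht => (hd t (hτ₀.trans (mem_Ioi.1 ht).le)).mono
        (Ioi_subset_Ici_self.trans (Ici_subset_Ici.2 hτ₀))
    · rw [interior_Ici]
      intro t ht
      have h1 := Real.rpow_nonneg (hpos t (hτ₀.trans (mem_Ioi.1 ht).le)).le k
      have h2 : 1 ≤ Y t / c := (one_le_div hc).2 (hY t (mem_Ioi.1 ht).le)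
      exact mul_nonpos_of_nonneg_of_nonpos h1 (by linarith)
  have h1 := hanti (mem_Ici.2 le_rfl) (mem_Ici.2 hτ) hτ
  have h2 : 0 ≤ S τ ^ k / (k * c) :=
    div_nonneg (Real.rpow_nonneg (hpos τ (hτ₀.trans hτ)).le k) (by positivity)
  simp only at h1
  linarith

/-! ### Return to the original variables -/

/-- A function on `[0, ∞)` that is bounded above and has positive derivative converges to some `b`
and has a differentiable inverse `σ : [X 0, b) → [0, ∞)`. At the endpoint `X 0` the derivative is one-sided. -/
theorem exists_inverse_of_strictMonoOn {X X' : ℝ → ℝ} {B : ℝ}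
    (hX : ∀ τ, 0 ≤ τ → HasDerivWithinAt X (X' τ) (Ici 0) τ) (hX' : ∀ τ, 0 ≤ τ → 0 < X' τ)
    (hB : ∀ᶠ τ in atTop, X τ ≤ B) :
    ∃ (b : ℝ) (σ : ℝ → ℝ), X 0 < b ∧ Tendsto X atTop (𝓝 b) ∧ σ (X 0) = 0 ∧
      (∀ χ ∈ Ico (X 0) b, 0 ≤ σ χ ∧ X (σ χ) = χ) ∧ Tendsto σ (𝓝[<] b) atTop ∧
      ∀ χ ∈ Ico (X 0) b, HasDerivWithinAt σ (X' (σ χ))⁻¹ (Ico (X 0) b) χ := by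
  have hcont : ContinuousOn X (Ici 0) := fun τ hτ => (hX τ hτ).continuousWithinAt
  have hmono : StrictMonoOn X (Ici 0) := by
    refine strictMonoOn_of_hasDerivWithinAt_pos (convex_Ici 0) hcont (f' := X') ?_ ?_
    · rw [interior_Ici]
      exact fun τ hτ => (hX τ (mem_Ioi.1 hτ).le).mono Ioi_subset_Ici_self
    · rw [interior_Ici]
      exact fun τ hτ => hX' τ (mem_Ioi.1 hτ).le
  have hbdd : BddAbove (X '' Ici 0) := by
    refine ⟨B, ?_⟩
    rintro _ ⟨τ, hτ, rfl⟩
    obtain ⟨t, htB, hτt⟩ := (hB.and (eventually_ge_atTop τ)).exists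
    exact (hmono.monotoneOn hτ (mem_Ici.2 (hτ.trans hτt)) hτt).trans htB
  have hne : (X '' Ici 0).Nonempty := ⟨X 0, 0, self_mem_Ici, rfl⟩
  set b := sSup (X '' Ici 0) with hb
  have hle : ∀ τ, 0 ≤ τ → X τ ≤ b := fun τ hτ => le_csSup hbdd ⟨τ, hτ, rfl⟩
  have hlt : ∀ τ, 0 ≤ τ → X τ < b := fun τ hτ =>
    (hmono (mem_Ici.2 hτ) (mem_Ici.2 (by linarith : (0 : ℝ) ≤ τ + 1)) (lt_add_one τ)).trans_le
      (hle _ (by linarith))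
  have hex : ∀ χ, χ < b → ∃ τ, 0 ≤ τ ∧ χ < X τ := fun χ hχ => by
    obtain ⟨_, ⟨τ, hτ, rfl⟩, h⟩ := exists_lt_of_lt_csSup hne hχ
    exact ⟨τ, hτ, h⟩
  have himage : X '' Ici 0 = Ico (X 0) b := by
    ext χ
    constructor
    · rintro ⟨τ, hτ, rfl⟩
      exact ⟨hmono.monotoneOn self_mem_Ici hτ hτ, hlt τ hτ⟩
    · rintro ⟨h1, h2⟩
      obtain ⟨τ, hτ, h3⟩ := hex χ h2
      exact image_mono Icc_subset_Ici_self
        (intermediate_value_Icc hτ (hcont.mono Icc_subset_Ici_self) ⟨h1, h3.le⟩)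
  set σ := Function.invFunOn X (Ici 0) with hσ
  have hσ_mem : ∀ χ ∈ Ico (X 0) b, 0 ≤ σ χ ∧ X (σ χ) = χ := fun χ hχ => by
    rw [← himage] at hχ
    exact ⟨Function.invFunOn_mem hχ, Function.invFunOn_eq hχ⟩
  have hσX : ∀ τ, 0 ≤ τ → σ (X τ) = τ := fun τ hτ =>
    hmono.injOn.leftInvOn_invFunOn (mem_Ici.2 hτ)
  have hσmono : StrictMonoOn σ (Ico (X 0) b) := fun χ hχ χ' hχ' hlt' => by
    rw [← hmono.lt_iff_lt (hσ_mem χ hχ).1 (hσ_mem χ' hχ').1, (hσ_mem χ hχ).2, (hσ_mem χ' hχ').2]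
    exact hlt'
  have hσcont : ContinuousOn σ (Ico (X 0) b) := by
    intro χ hχ
    refine tendsto_order.2 ⟨fun a ha => ?_, fun a ha => ?_⟩
    · rcases lt_or_ge a 0 with ha0 | ha0
      · filter_upwards [self_mem_nhdsWithin] with y hy using ha0.trans_le (hσ_mem y hy).1
      · have h1 := hmono ha0 (hσ_mem χ hχ).1 ha
        rw [(hσ_mem χ hχ).2] at h1
        filter_upwards [self_mem_nhdsWithin, mem_nhdsWithin_of_mem_nhds (Ioi_mem_nhds h1)]
          with y hy hay
        rwa [← hmono.lt_iff_lt ha0 (hσ_mem y hy).1, (hσ_mem y hy).2]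
    · have ha0 : 0 ≤ a := (hσ_mem χ hχ).1.trans ha.le
      have h1 := hmono (hσ_mem χ hχ).1 ha0 ha
      rw [(hσ_mem χ hχ).2] at h1
      filter_upwards [self_mem_nhdsWithin, mem_nhdsWithin_of_mem_nhds (Iio_mem_nhds h1)]
        with y hy hay
      rwa [← hmono.lt_iff_lt (hσ_mem y hy).1 ha0, (hσ_mem y hy).2]
  refine ⟨b, σ, hlt 0 le_rfl, ?_, hσX 0 le_rfl, hσ_mem, ?_, ?_⟩
  · rw [tendsto_order]
    constructor
    · intro a ha
      obtain ⟨τ, hτ, h⟩ := hex a ha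
      filter_upwards [eventually_ge_atTop τ] with t ht
      exact h.trans_le (hmono.monotoneOn (mem_Ici.2 hτ) (mem_Ici.2 (hτ.trans ht)) ht)
    · intro a ha
      filter_upwards [eventually_ge_atTop 0] with t ht
      exact (hlt t ht).trans ha
  · rw [tendsto_atTop]
    intro N
    have hN : 0 ≤ max N 0 := le_max_right _ _
    have h0 : X 0 ≤ X (max N 0) := hmono.monotoneOn self_mem_Ici (mem_Ici.2 hN) hN
    filter_upwards [Ico_mem_nhdsLT (hlt _ hN)] with χ hχ
    have h1 := hσmono.monotoneOn ⟨h0, hlt _ hN⟩ ⟨h0.trans hχ.1, hχ.2⟩ hχ.1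
    rw [hσX _ hN] at h1
    exact (le_max_left _ _).trans h1
  · intro χ hχ
    obtain ⟨h1, h2⟩ := hσ_mem χ hχ
    have hd : HasFDerivWithinAt X (ContinuousLinearEquiv.unitsEquivAut ℝ
        (Units.mk0 _ (hX' _ h1).ne') : ℝ →L[ℝ] ℝ) (Ici 0) (σ χ) :=
      (hX _ h1).hasFDerivWithinAt.congr_fderiv (by ext; simp)
    have htend : Tendsto σ (𝓝[Ico (X 0) b] χ) (𝓝[Ici 0] (σ χ)) :=
      (hσcont χ hχ).tendsto_nhdsWithin fun y hy => (hσ_mem y hy).1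
    have := hd.of_local_left_inverse htend hχ
      (eventually_nhdsWithin_of_forall fun y hy => (hσ_mem y hy).2)
    simpa using this.hasDerivWithinAt

/-- The chain rule behind the desingularization: a curve `(χ, S, Y)` of the desingularized system,
reparametrized by `σ` with `dσ/dχ = S ^ (m - 1)`, is mapped by `u = 1 / s`, `v = x / s` to a curve
of the profile system. -/
theorem hasDerivWithinAt_unembed {m α β χ : ℝ} {S Y σ : ℝ → ℝ} {I : Set ℝ}
    (hpos : 0 < S (σ χ))
    (hS : HasDerivWithinAt S (-S (σ χ) * Y (σ χ)) (Ici 0) (σ χ))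
    (hY : HasDerivWithinAt Y (-Y (σ χ) ^ 2 - β * χ * Y (σ χ) - α * S (σ χ) ^ (1 - m))
      (Ici 0) (σ χ))
    (hσ : HasDerivWithinAt σ (S (σ χ) ^ (1 - m))⁻¹ I χ) (hmaps : MapsTo σ I (Ici 0)) :
    HasDerivWithinAt (fun y => (y, (S (σ y))⁻¹, Y (σ y) / S (σ y)))
      (profileField m α β (χ, (S (σ χ))⁻¹, Y (σ χ) / S (σ χ))) I χ := by
  have hS' := hS.comp χ hσ hmaps
  have hY' := hY.comp χ hσ hmaps
  have hk : (0 : ℝ) < S (σ χ) ^ (1 - m) := Real.rpow_pos_of_pos hpos _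
  have hu := (hS'.fun_inv hpos.ne').congr_deriv
    (g' := ((S (σ χ))⁻¹ ^ (1 - m) * (Y (σ χ) / S (σ χ)))) (by
      rw [Real.inv_rpow hpos.le]
      simp only [Function.comp_apply]
      field_simp)
  have hv := (hY'.fun_div hS' hpos.ne').congr_deriv
    (g' := (-β * χ * (S (σ χ))⁻¹ ^ (1 - m) * (Y (σ χ) / S (σ χ)) - α * (S (σ χ))⁻¹)) (by
      rw [Real.inv_rpow hpos.le]
      simp only [Function.comp_apply]
      field_simp
      ring)
  exact (hasDerivWithinAt_id χ I).prodMk (hu.prodMk hv)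

/-- The orbit on the stable manifold, read in the original variables. -/
theorem exists_blowup_solution {m α β χ₀ u₀ v₀ : ℝ} (hm : m < 0) (hβ : β < 0) (hχ₀ : 0 < χ₀)
    (hu₀ : 0 < u₀)
    (hW : directionalEmbedding (χ₀, u₀, v₀) ∈
      stableManifold (desingField m α β) desingDomain (equilibriumBranch β χ₀)) :
    ∃ (b : ℝ) (u v : ℝ → ℝ), χ₀ < b ∧ IsProfileSolution m α β χ₀ u₀ v₀ (b : EReal) u v ∧
      Tendsto u (𝓝[<] b) atTop ∧ Tendsto (fun χ => v χ / u χ) (𝓝[<] b) (𝓝 (-β * b)) := by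
  obtain ⟨γ, h0, hγ, -, hlim⟩ := hW
  have hk : 0 < 1 - m := by linarith
  set X : ℝ → ℝ := fun τ => (γ τ).1 with hXdef
  set S : ℝ → ℝ := fun τ => (γ τ).2.1 with hSdef
  set Y : ℝ → ℝ := fun τ => (γ τ).2.2 with hYdef
  have hX : ∀ τ, 0 ≤ τ → HasDerivWithinAt X (S τ ^ (1 - m)) (Ici 0) τ := fun τ hτ =>
    (hγ τ hτ).fst
  have hS : ∀ τ, 0 ≤ τ → HasDerivWithinAt S (-S τ * Y τ) (Ici 0) τ := fun τ hτ =>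
    (hγ τ hτ).snd.fst
  have hY : ∀ τ, 0 ≤ τ → HasDerivWithinAt Y
      (-Y τ ^ 2 - β * X τ * Y τ - α * S τ ^ (1 - m)) (Ici 0) τ := fun τ hτ =>
    (hγ τ hτ).snd.snd
  have hX0 : X 0 = χ₀ := by simp [hXdef, h0, directionalEmbedding]
  have hS0 : S 0 = 1 / u₀ := by simp [hSdef, h0, directionalEmbedding]
  have hY0 : Y 0 = v₀ / u₀ := by simp [hYdef, h0, directionalEmbedding]
  have hpos : ∀ τ, 0 ≤ τ → 0 < S τ := fun τ hτ =>
    pos_of_hasDerivWithinAt_neg_mul hS (fun t ht => (hY t ht).continuousWithinAt)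
      (by rw [hS0]; positivity) hτ
  have hSlim : Tendsto S atTop (𝓝 0) :=
    squeeze_zero_norm (fun τ => (abs_le_infDist_equilibriumBranch β χ₀ (γ τ)).1) hlim
  have hYlim : Tendsto (fun τ => Y τ + β * X τ) atTop (𝓝 0) :=
    squeeze_zero_norm (fun τ => (abs_le_infDist_equilibriumBranch β χ₀ (γ τ)).2.1)
      (by simpa using hlim.const_mul (1 + |β|))
  -- Eventually `X ≥ χ₀ / 2`, so `-β X` is at least twice the constant below, and `Y` differs
  -- from `-β X` by less than that constant.
  have hc : 0 < -β * χ₀ / 4 := by nlinarith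
  have hYev : ∀ᶠ τ in atTop, -β * χ₀ / 4 ≤ Y τ := by
    filter_upwards [hYlim.eventually (lt_mem_nhds (neg_lt_zero.2 hc)),
      hlim.eventually (gt_mem_nhds (half_pos hχ₀))] with τ h1 h2
    have h3 := (abs_le_infDist_equilibriumBranch β χ₀ (γ τ)).2.2
    have h4 : χ₀ / 2 ≤ X τ := by simp only [hXdef]; linarith
    nlinarith
  obtain ⟨τ₀, hτ₀⟩ := eventually_atTop.1 hYev
  obtain ⟨b, σ, hb, hXlim, hσ0, hσ, hσlim, hσd⟩ := exists_inverse_of_strictMonoOn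
    (X' := fun τ => S τ ^ (1 - m)) hX (fun τ hτ => Real.rpow_pos_of_pos (hpos τ hτ) _)
    ((eventually_ge_atTop (max τ₀ 0)).mono fun τ hτ =>
      le_add_rpow_div_of_rate hk hc (le_max_right τ₀ 0) hX hS hpos
        (fun t ht => hτ₀ t ((le_max_left _ _).trans ht)) hτ)
  rw [hX0] at hb hσ0 hσ hσd
  have hYb : Tendsto Y atTop (𝓝 (-β * b)) := by
    have := hYlim.sub (hXlim.const_mul β)
    simpa using this
  have hev : ∀ᶠ χ in 𝓝[<] b, χ ∈ Ico χ₀ b := Ico_mem_nhdsLT hb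
  refine ⟨b, fun χ => (S (σ χ))⁻¹, fun χ => Y (σ χ) / S (σ χ), hb,
    ⟨EReal.coe_lt_coe_iff.2 hb, by simp [hσ0, hS0], ?_, ?_, ?_⟩, ?_, ?_⟩
  · simp only [hσ0, hS0, hY0]
    field_simp
  · rw [forwardInterval_coe]
    exact fun χ hχ => inv_pos.2 (hpos _ (hσ χ hχ).1)
  · rw [forwardInterval_coe]
    intro χ hχ
    obtain ⟨h1, h2⟩ := hσ χ hχ
    refine hasDerivWithinAt_unembed (hpos _ h1) (hS _ h1) ?_ (hσd χ hχ)
      fun y hy => (hσ y hy).1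
    have := hY _ h1
    rwa [h2] at this
  · refine Tendsto.inv_tendsto_nhdsGT_zero
      (tendsto_nhdsWithin_iff.2 ⟨hSlim.comp hσlim, ?_⟩)
    filter_upwards [hev] with χ hχ using hpos _ (hσ χ hχ).1
  · refine (hYb.comp hσlim).congr' ?_
    filter_upwards [hev] with χ hχ
    have := (hpos _ (hσ χ hχ).1).ne'
    simp only [Function.comp_apply]
    field_simp

theorem theorem6p1 (m α β : ℝ) (hm : m < 0) (hβ : β < 0)
    (χ₀ u₀ v₀ : ℝ) (hχ₀ : 0 < χ₀) (hu₀ : 0 < u₀)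
    (hW : directionalEmbedding (χ₀, u₀, v₀) ∈
      stableManifold (desingField m α β) desingDomain (equilibriumBranch β χ₀)) :
    ∃ χmax c_u c_v : ℝ, χ₀ < χmax ∧ 0 < c_u ∧ 0 < c_v ∧
      (∃ u v : ℝ → ℝ, IsMaximalProfileSolution m α β χ₀ u₀ v₀ (χmax : EReal) u v) ∧
      ∀ (T : EReal) (u v : ℝ → ℝ), IsMaximalProfileSolution m α β χ₀ u₀ v₀ T u v →
        T = (χmax : EReal) ∧
        Tendsto u (𝓝[<] χmax) atTop ∧
        Tendsto v (𝓝[<] χmax) atTop ∧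
        Asymptotics.IsEquivalent (𝓝[<] χmax) u
          (fun χ => c_u * (χmax - χ) ^ (-(1 / (1 - m)))) ∧
        Asymptotics.IsEquivalent (𝓝[<] χmax) v
          (fun χ => c_v * (χmax - χ) ^ (-(1 / (1 - m)))) := by
  obtain ⟨b, u₁, v₁, hb, hsol, hu₁, hv₁⟩ := exists_blowup_solution hm hβ hχ₀ hu₀ hW
  have hℓ : 0 < -β * b := mul_pos (neg_pos.2 hβ) (hχ₀.trans hb)
  have hm1 : 0 < 1 - m := by linarith
  have hcu : 0 < ((1 - m) * (-β * b)) ^ (-(1 / (1 - m))) := by positivity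
  refine ⟨b, _, -β * b * ((1 - m) * (-β * b)) ^ (-(1 / (1 - m))), hb, hcu, mul_pos hℓ hcu,
    ⟨u₁, v₁, hsol.isMaximal_of_tendsto_atTop hu₁⟩, ?_⟩
  intro T u v h
  obtain rfl : T = (b : EReal) := h.eq_of_tendsto_atTop hsol hu₁
  have heq : ∀ᶠ χ in 𝓝[<] b, u₁ χ = u χ ∧ v₁ χ = v χ := by
    filter_upwards [Ico_mem_nhdsLT hb] with χ hχ
    have hχb : (χ : EReal) < b := EReal.coe_lt_coe_iff.2 hχ.2
    exact hsol.eq_of_lt h.toIsProfileSolution hχ.1 hχb hχb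
  have hu : Tendsto u (𝓝[<] b) atTop := hu₁.congr' (heq.mono fun χ hχ => hχ.1)
  have hvu : Tendsto (fun χ => v χ / u χ) (𝓝[<] b) (𝓝 (-β * b)) :=
    hv₁.congr' (heq.mono fun χ hχ => by rw [hχ.1, hχ.2])
  have hu0 : ∀ᶠ χ in 𝓝[<] b, u χ ≠ 0 := hu.eventually_ne_atTop 0
  have hpow : ∀ᶠ χ in 𝓝[<] b, (b - χ) ^ (-(1 / (1 - m))) ≠ 0 := by
    filter_upwards [self_mem_nhdsWithin] with χ hχ
    exact (Real.rpow_pos_of_pos (sub_pos.2 hχ) _).ne'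
  have hulim := h.toIsProfileSolution.tendsto_div_rpow hm hu hℓ hvu
  refine ⟨rfl, hu, ?_, isEquivalent_const_mul_of_tendsto_div hcu.ne' hulim hpow,
    isEquivalent_const_mul_of_tendsto_div (mul_pos hℓ hcu).ne'
      ((hvu.mul hulim).congr' ?_) hpow⟩
  · refine (hvu.pos_mul_atTop hℓ hu).congr' ?_
    filter_upwards [hu0] with χ hχ using div_mul_cancel₀ _ hχ
  · filter_upwards [hu0] with χ hχ using div_mul_div_cancel₀ hχ
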